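/- Let $H^2(\mathbb{D})$ be the Hardy space of the open unit disc $\mathbb{D}$, that is, the Hilbert space of the functions $f(z)=\sum_{k\ge 0}a_kz^k$ with $\|f\|^2=\sum_{k\ge 0}|a_k|^2<\infty$, and let $M_z$ be the unilateral shift, $(M_zf)(z)=zf(z)$. An inner function is a bounded analytic function $\theta$ on $\mathbb{D}$ whose boundary function has modulus $1$ almost everywhere on the unit circle. For a natural number $n$, a bounded linear operator $F$ on $H^2(\mathbb{D})$ is called an $n$-perturbation if (i) $Fz^m=0$ for all $m\ge n$, (ii) $F(z^mH^2(\mathbb{D}))\subseteq z^{m+1}\mathbb{C}[z]$ for all $m\ge 0$, and (iii) $M_z+F$ is left-invertible (it has a bounded left inverse). All sums $\oplus$ below are orthogonal. **Theorem.** Let $F$ be an $n$-perturbation on $H^2(\mathbb{D})$, let $S_n=M_z+F$, and let $\mathcal{M}$ be a nonzero closed subspace of $H^2(\mathbb{D})$. Then $\mathcal{M}$ is invariant under $S_n$ if and only if there exist an inner function $\theta$ and polynomials $p_0,\dots,p_{n-1},q_0,\dots,q_{n-1}\in\mathbb{C}[z]$ such that $$\mathcal{M}=(\mathbb{C}\varphi_0\oplus\mathbb{C}\varphi_1\oplus\cdots\oplus\mathbb{C}\varphi_{n-1})\oplus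 z^n\theta H^2(\mathbb{D}),$$ where $\varphi_i=z^ip_i\theta-q_i$ for all $i=0,\dots,n-1$, and $$S_n\varphi_j\in(\mathbb{C}\varphi_{j+1}\oplus\cdots\oplus\mathbb{C}\varphi_{n-1})\oplus z^n\theta H^2(\mathbb{D})\qquad\text{for all } j=0,\dots,n-2,$$ and $S_n\varphi_{n-1}=z^np_{n-1}\theta$. Moreover, if $\mathcal{M}$ is invariant under $S_n$, then $\theta$, $p_i$, $q_i$ can be chosen so that, in addition, $\varphi_i\ne 0$ for all $i=0,\dots,n-1$. -/

import Mathlib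

open scoped ENNReal Polynomial
open MeasureTheory

/-- The Hardy space `H²(𝔻)`, the space of functions `f(z) = ∑ aₖ zᵏ` on the open unit disc with
`∑ |aₖ|² < ∞` and `⟨∑ aₖ zᵏ, ∑ bₖ zᵏ⟩ = ∑ aₖ b̄ₖ`; a function is stored as its sequence `(aₖ)` of
Taylor coefficients and evaluated by `HardySpace.eval`. (Mathlib's `inner ℂ f g` is linear in the
second argument.) -/
abbrev HardySpace : Type := lp (fun _ : ℕ => ℂ) 2

namespace HardySpace

/-- The value at `z` (for `|z| < 1`) of the analytic function with Taylor coefficients `f k`. -/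
noncomputable def eval (f : HardySpace) (z : ℂ) : ℂ := ∑' k : ℕ, f k * z ^ k

theorem summable_eval (f : HardySpace) {z : ℂ} (hz : z ∈ Metric.ball (0 : ℂ) 1) :
    Summable fun k : ℕ => f k * z ^ k := by
  have hz' : ‖z‖ < 1 := by simpa using hz
  refine Summable.of_norm_bounded
    ((summable_geometric_of_lt_one (norm_nonneg z) hz').mul_left ‖f‖) fun k => ?_
  rw [norm_mul, norm_pow]
  exact mul_le_mul_of_nonneg_right (lp.norm_apply_le_norm (by norm_num) f k) (by positivity)

theorem eval_zero (z : ℂ) : eval 0 z = 0 := by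
  simp [eval]

theorem eval_add (f g : HardySpace) {z : ℂ} (hz : z ∈ Metric.ball (0 : ℂ) 1) :
    eval (f + g) z = eval f z + eval g z := by
  simp only [eval, lp.coeFn_add, Pi.add_apply, add_mul]
  exact (summable_eval f hz).tsum_add (summable_eval g hz)

theorem eval_smul (c : ℂ) (f : HardySpace) (z : ℂ) : eval (c • f) z = c * eval f z := by
  simp only [eval, lp.coeFn_smul, Pi.smul_apply, smul_eq_mul, mul_assoc]
  exact tsum_mul_left

/-- The monomial `zᵐ` as an element of `H²(𝔻)`. -/
noncomputable def monomial (m : ℕ) : HardySpace := lp.single 2 m (1 : ℂ)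

/-- Coefficients of `z f(z)`: `0, a₀, a₁, …`. -/
def shiftSeq (a : ℕ → ℂ) : ℕ → ℂ
  | 0 => 0
  | k + 1 => a k

theorem hasSum_shiftSeq (f : HardySpace) :
    HasSum (fun k => ‖shiftSeq f k‖ ^ (2 : ℝ≥0∞).toReal) (‖f‖ ^ (2 : ℝ≥0∞).toReal) := by
  have h := lp.hasSum_norm (p := 2) (by norm_num) f
  refine (hasSum_nat_add_iff' 1).mp ?_
  simpa [shiftSeq] using h

theorem memℓp_shiftSeq (f : HardySpace) : Memℓp (shiftSeq f) 2 :=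
  memℓp_gen (hasSum_shiftSeq f).summable

/-- The unilateral shift `M_z` on `H²(𝔻)`, that is, `(M_z f)(z) = z f(z)` (see `eval_Mz`). -/
noncomputable def Mz : HardySpace →L[ℂ] HardySpace :=
  LinearMap.mkContinuous
    { toFun := fun f => ⟨shiftSeq f, memℓp_shiftSeq f⟩
      map_add' := fun f g => by
        ext k
        cases k
        · exact (add_zero (0 : ℂ)).symm
        · rfl
      map_smul' := fun c f => by
        ext k
        cases k <;> simp [shiftSeq] }
    1 (fun f => by
      have h1 := (lp.hasSum_norm (p := 2) (by norm_num)
        (⟨shiftSeq f, memℓp_shiftSeq f⟩ : HardySpace)).unique (hasSum_shiftSeq f)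
      rw [one_mul]
      exact le_of_eq (Real.rpow_left_injOn (by norm_num) (norm_nonneg _) (norm_nonneg _) h1))

theorem eval_Mz (f : HardySpace) {z : ℂ} (hz : z ∈ Metric.ball (0 : ℂ) 1) :
    eval (Mz f) z = z * eval f z := by
  have h := (summable_eval (Mz f) hz).tsum_eq_zero_add
  have h0 : (Mz f) 0 = 0 := rfl
  have h1 : ∀ k, (Mz f) (k + 1) = f k := fun _ => rfl
  simp only [eval]
  rw [h, h0, ← tsum_mul_left]
  simp only [h1, zero_mul, zero_add]
  exact tsum_congr fun k => by ring

/-- The boundary function of `f(z) = ∑ aₖ zᵏ`: the element `∑ aₖ e^{2πikt}` of `L²` of the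
unit circle (parametrized as `e^{2πit}`, `t ∈ ℝ / ℤ`, with normalized arc length), whose
`k`-th Fourier coefficient is `aₖ` for `k ≥ 0` and `0` for `k < 0`. -/
noncomputable def boundary (f : HardySpace) :
    Lp ℂ 2 (AddCircle.haarAddCircle (T := (1 : ℝ))) :=
  ∑' k : ℕ, f k • fourierLp (T := (1 : ℝ)) 2 (k : ℤ)

/-- The series defining the boundary function converges in `L²`. -/
theorem hasSum_boundary (f : HardySpace) :
    HasSum (fun k : ℕ => f k • fourierLp (T := (1 : ℝ)) 2 (k : ℤ)) (boundary f) := by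
  have ho : Orthonormal ℂ fun k : ℕ => fourierLp (T := (1 : ℝ)) 2 (k : ℤ) :=
    orthonormal_fourier.comp _ Nat.cast_injective
  exact (ho.orthogonalFamily.summable_of_lp f).hasSum

/-- Inner functions: bounded analytic functions on `𝔻` (elements of `H^∞(𝔻)`) whose boundary
function has modulus one almost everywhere on the unit circle. -/
structure IsInner (θ : ℂ → ℂ) : Prop where
  analytic : AnalyticOnNhd ℂ θ (Metric.ball 0 1)
  bounded : ∃ C : ℝ, ∀ z ∈ Metric.ball (0 : ℂ) 1, ‖θ z‖ ≤ C
  unimodular : ∃ f : HardySpace, (∀ z ∈ Metric.ball (0 : ℂ) 1, eval f z = θ z) ∧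
    ∀ᵐ t ∂(AddCircle.haarAddCircle (T := (1 : ℝ))), ‖boundary f t‖ = 1

/-- The subspace `zⁿ θ H²(𝔻)` of `H²(𝔻)`. -/
def multRange (n : ℕ) (θ : ℂ → ℂ) : Submodule ℂ HardySpace where
  carrier := {g | ∃ h : HardySpace, ∀ z ∈ Metric.ball (0 : ℂ) 1,
    eval g z = z ^ n * θ z * eval h z}
  zero_mem' := ⟨0, fun z _ => by simp [eval_zero]⟩
  add_mem' := by
    rintro g₁ g₂ ⟨h₁, e₁⟩ ⟨h₂, e₂⟩
    refine ⟨h₁ + h₂, fun z hz => ?_⟩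
    rw [eval_add _ _ hz, eval_add _ _ hz, e₁ z hz, e₂ z hz]
    ring
  smul_mem' := by
    rintro c g ⟨h, e⟩
    refine ⟨c • h, fun z hz => ?_⟩
    rw [eval_smul, eval_smul, e z hz]
    ring

/-- `F` is an `n`-perturbation on `H²(𝔻)`. -/
structure IsPerturbation (n : ℕ) (F : HardySpace →L[ℂ] HardySpace) : Prop where
  /-- `F zᵐ = 0` for all `m ≥ n`. -/
  map_monomial : ∀ m : ℕ, n ≤ m → F (monomial m) = 0
  /-- `F (zᵐ H²(𝔻)) ⊆ zᵐ⁺¹ ℂ[z]` for all `m ≥ 0`. -/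
  map_range : ∀ (m : ℕ) (f : HardySpace), ∃ r : ℂ[X], ∀ z ∈ Metric.ball (0 : ℂ) 1,
    eval (F ((Mz ^ m) f)) z = z ^ (m + 1) * r.eval z
  /-- `M_z + F` is left-invertible. -/
  left_invertible : ∃ L : HardySpace →L[ℂ] HardySpace, L ∘L (Mz + F) = .id ℂ HardySpace

/-- The representation
`M = (ℂ φ₀ ⊕ ⋯ ⊕ ℂ φₙ₋₁) ⊕ zⁿ θ H²(𝔻)` (orthogonal sums), where `φᵢ = zⁱ pᵢ θ - qᵢ`,
`S φⱼ ∈ (ℂ φⱼ₊₁ ⊕ ⋯ ⊕ ℂ φₙ₋₁) ⊕ zⁿ θ H²(𝔻)` for `j + 1 < n`, and `S φₙ₋₁ = zⁿ pₙ₋₁ θ`. -/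
structure IsRepresentation (n : ℕ) (S : HardySpace →L[ℂ] HardySpace)
    (M : Submodule ℂ HardySpace) (θ : ℂ → ℂ) (p q : Fin n → ℂ[X])
    (φ : Fin n → HardySpace) : Prop where
  eval_φ : ∀ i : Fin n, ∀ z ∈ Metric.ball (0 : ℂ) 1,
    eval (φ i) z = z ^ (i : ℕ) * (p i).eval z * θ z - (q i).eval z
  orthogonal : ∀ i j : Fin n, i ≠ j → inner ℂ (φ i) (φ j) = 0
  orthogonal_range : ∀ i : Fin n, ∀ g ∈ multRange n θ, inner ℂ (φ i) g = 0
  eq_sup : M = Submodule.span ℂ (Set.range φ) ⊔ multRange n θ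
  map_mem : ∀ j : Fin n, (j : ℕ) + 1 < n →
    S (φ j) ∈ Submodule.span ℂ (φ '' {i | j < i}) ⊔ multRange n θ
  map_last : ∀ j : Fin n, (j : ℕ) + 1 = n → ∀ z ∈ Metric.ball (0 : ℂ) 1,
    eval (S (φ j)) z = z ^ n * (p j).eval z * θ z

end HardySpace

/-!
Write `S = M_z + F`. Since `F` annihilates `zⁿ H²` and raises the order of vanishing at the origin,
`S` agrees with `M_z` on `zⁿ H²`, maps `zᵐ H²` into `zᵐ⁺¹ H²`, and `Sᵏ f - zᵏ f ∈ zᵏ ℂ[z]` for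
every `f`.

Let `M` be a nonzero closed `S`-invariant subspace. The subspace `Sⁿ M` is closed, contained in
`zⁿ H²` and invariant under the shift, so Beurling's theorem gives `Sⁿ M = zⁿ θ H²`
(`IsPerturbation.exists_eq_multRange`). Moreover `M ⊖ S M` is one-dimensional: it is nonzero because
`S` raises orders of vanishing, and the bound `dim (M ∩ zᵏ H²) / S (M ∩ zᵏ H²) ≤ 1` is proved
downwards from `k = n`, where it is Beurling's theorem, using that `S` is injective
(`IsPerturbation.exists_generator`). Applied to each `Sⁱ M`, this produces a unit vector `φᵢ`
spanning `Sⁱ M ⊖ Sⁱ⁺¹ M`, whence `M = ℂ φ₀ ⊕ ⋯ ⊕ ℂ φₙ₋₁ ⊕ zⁿ θ H²`. From `Sⁿ⁻ⁱ φᵢ ∈ zⁿ θ H²` one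
gets `φᵢ = zⁱ θ h - q` with `q` a polynomial, and `φᵢ ⟂ zⁿ θ H²` forces `h` to be a polynomial
(`IsPerturbation.exists_polynomials`). The converse
follows from the prescribed form of `S φⱼ` and from `S = M_z` on `zⁿ H² ⊇ zⁿ θ H²`.

Beurling's theorem is proved on Taylor coefficients. A unit vector `θ` of `N ⊖ z N` has
`⟨θ, zᵏ θ⟩ = 0` for `k ≥ 1`, so multiplication by `θ` is an isometry of `H²`; iterating it shows
`|θ| ≤ 1` on the disc. That `|θ| = 1` almost everywhere on the circle holds because the measure
`|θ|² dt` has the same Fourier coefficients as `dt`. If `N ⊖ θ H²` were nonzero, it would be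
invariant and contain a vector `ψ` of the same kind, and `θ ψ ≠ 0` would lie both in it and in
`θ H²` (`exists_eq_range_mulOp`).
-/

namespace HardySpace

/-! ### Coefficients, evaluation and the shift -/

theorem Mz_apply_zero (f : HardySpace) : Mz f 0 = 0 := rfl

theorem Mz_apply_succ (f : HardySpace) (k : ℕ) : Mz f (k + 1) = f k := rfl

theorem Mz_pow_apply_add (m : ℕ) (f : HardySpace) (k : ℕ) : (Mz ^ m) f (k + m) = f k := by
  induction m with
  | zero => rfl
  | succ m ih =>
    rw [pow_succ', mul_apply_eq_comp, ← add_assoc, Mz_apply_succ, ih]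

theorem Mz_pow_apply_of_lt (m : ℕ) (f : HardySpace) {k : ℕ} (hk : k < m) :
    (Mz ^ m) f k = 0 := by
  induction m generalizing k with
  | zero => omega
  | succ m ih =>
    rw [pow_succ', mul_apply_eq_comp]
    cases k with
    | zero => rfl
    | succ k => rw [Mz_apply_succ, ih (by omega)]

theorem inner_Mz_Mz (f g : HardySpace) : inner ℂ (Mz f) (Mz g) = inner ℂ f g := by
  have h := lp.hasSum_inner (𝕜 := ℂ) (Mz f) (Mz g)
  have h' := (hasSum_nat_add_iff' 1).mpr h
  simp only [Mz_apply_succ, Finset.range_one, Finset.sum_singleton, Mz_apply_zero,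
    inner_zero_left, sub_zero] at h'
  exact h'.unique (lp.hasSum_inner f g)

theorem inner_Mz_pow_Mz_pow (m : ℕ) (f g : HardySpace) :
    inner ℂ ((Mz ^ m) f) ((Mz ^ m) g) = inner ℂ f g := by
  induction m with
  | zero => rfl
  | succ m ih =>
    rw [pow_succ', mul_apply_eq_comp, mul_apply_eq_comp, inner_Mz_Mz, ih]

/-- `Mz ^ m` as a linear isometry. -/
noncomputable def MzPowIsometry (m : ℕ) : HardySpace →ₗᵢ[ℂ] HardySpace :=
  LinearMap.isometryOfInner (Mz ^ m).toLinearMap (inner_Mz_pow_Mz_pow m)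

theorem Mz_pow_injective (m : ℕ) : Function.Injective (Mz ^ m : HardySpace →L[ℂ] HardySpace) :=
  (MzPowIsometry m).injective

theorem eval_Mz_pow (m : ℕ) (f : HardySpace) {z : ℂ} (hz : z ∈ Metric.ball (0 : ℂ) 1) :
    eval ((Mz ^ m) f) z = z ^ m * eval f z := by
  induction m with
  | zero => simp
  | succ m ih =>
    rw [pow_succ', mul_apply_eq_comp, eval_Mz _ hz, ih, pow_succ']
    ring

theorem monomial_apply (m k : ℕ) : monomial m k = if k = m then 1 else 0 := by
  rw [monomial, lp.single_apply, Pi.single_apply]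

theorem Mz_monomial (m : ℕ) : Mz (monomial m) = monomial (m + 1) := by
  ext k
  cases k with
  | zero => rw [Mz_apply_zero, monomial_apply]; simp
  | succ k => rw [Mz_apply_succ, monomial_apply, monomial_apply]; simp

theorem Mz_pow_monomial (m k : ℕ) : (Mz ^ m) (monomial k) = monomial (k + m) := by
  induction m with
  | zero => rfl
  | succ m ih => rw [pow_succ', mul_apply_eq_comp, ih, Mz_monomial, add_assoc]

theorem hasSum_monomial (f : HardySpace) : HasSum (fun k => f k • monomial k) f := by
  have h := lp.hasSum_single (p := 2) (by norm_num) f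
  refine h.congr_fun fun k => ?_
  rw [monomial, ← lp.single_smul, smul_eq_mul, mul_one]

theorem inner_monomial_left (m : ℕ) (f : HardySpace) : inner ℂ (monomial m) f = f m := by
  rw [monomial, lp.inner_single_left]
  simp

theorem norm_eval_le (f : HardySpace) {z : ℂ} (hz : z ∈ Metric.ball (0 : ℂ) 1) :
    ‖eval f z‖ ≤ (1 - ‖z‖)⁻¹ * ‖f‖ := by
  have hz' : ‖z‖ < 1 := by simpa using hz
  have hg := (hasSum_geometric_of_lt_one (norm_nonneg z) hz').mul_left ‖f‖
  rw [mul_comm]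
  refine tsum_of_norm_bounded hg fun k => ?_
  rw [norm_mul, norm_pow]
  exact mul_le_mul_of_nonneg_right (lp.norm_apply_le_norm (by norm_num) f k) (by positivity)

/-- Point evaluation at a point of the disc is a bounded functional. -/
noncomputable def evalCLM {z : ℂ} (hz : z ∈ Metric.ball (0 : ℂ) 1) : HardySpace →L[ℂ] ℂ :=
  LinearMap.mkContinuous
    { toFun := fun f => eval f z
      map_add' := fun f g => eval_add f g hz
      map_smul' := fun c f => eval_smul c f z }
    (1 - ‖z‖)⁻¹ (fun f => norm_eval_le f hz)

theorem evalCLM_apply {z : ℂ} (hz : z ∈ Metric.ball (0 : ℂ) 1) (f : HardySpace) :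
    evalCLM hz f = eval f z := rfl

theorem eval_sub (f g : HardySpace) {z : ℂ} (hz : z ∈ Metric.ball (0 : ℂ) 1) :
    eval (f - g) z = eval f z - eval g z :=
  map_sub (evalCLM hz) f g

theorem eval_monomial (m : ℕ) (z : ℂ) : eval (monomial m) z = z ^ m := by
  rw [eval, tsum_eq_single m]
  · simp [monomial_apply]
  · intro k hk
    simp [monomial_apply, hk]

theorem hasFPowerSeriesOnBall_eval (f : HardySpace) :
    HasFPowerSeriesOnBall (eval f) (FormalMultilinearSeries.ofScalars ℂ (fun k => f k)) 0 1 where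
  r_le := by
    refine ENNReal.le_of_forall_nnreal_lt fun r hr => ?_
    have hr' : (r : ℝ) < 1 := by exact_mod_cast hr
    refine FormalMultilinearSeries.le_radius_of_bound _ ‖f‖ fun k => ?_
    rw [FormalMultilinearSeries.ofScalars_norm]
    calc ‖f k‖ * (r : ℝ) ^ k ≤ ‖f‖ * 1 := by
          gcongr
          · exact lp.norm_apply_le_norm (by norm_num) f k
          · exact pow_le_one₀ r.2 hr'.le
      _ = ‖f‖ := mul_one _
  r_pos := one_pos
  hasSum := by
    intro z hz
    have hz' : z ∈ Metric.ball (0 : ℂ) 1 := by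
      rwa [← ENNReal.ofReal_one, Metric.eball_ofReal] at hz
    simp only [zero_add, FormalMultilinearSeries.ofScalars_apply_eq, smul_eq_mul]
    exact (summable_eval f hz').hasSum

theorem analyticOnNhd_eval (f : HardySpace) : AnalyticOnNhd ℂ (eval f) (Metric.ball 0 1) := by
  have h := (hasFPowerSeriesOnBall_eval f).analyticOnNhd
  rwa [← ENNReal.ofReal_one, Metric.eball_ofReal] at h

/-- An element of `H²` is determined by its values on the disc. -/
theorem ext_eval {f g : HardySpace}
    (h : ∀ z ∈ Metric.ball (0 : ℂ) 1, eval f z = eval g z) : f = g := by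
  have hp := HasFPowerSeriesAt.eq_formalMultilinearSeries_of_eventually
    (hasFPowerSeriesOnBall_eval f).hasFPowerSeriesAt
    (hasFPowerSeriesOnBall_eval g).hasFPowerSeriesAt
    (Filter.eventually_of_mem (Metric.ball_mem_nhds 0 one_pos) h)
  ext k
  have := congrArg (fun p : FormalMultilinearSeries ℂ ℂ ℂ => p.coeff k) hp
  simpa [FormalMultilinearSeries.coeff_ofScalars] using this

/-- The element of `H²` given by a polynomial. -/
noncomputable def ofPoly (r : ℂ[X]) : HardySpace := r.sum fun k a => a • monomial k

theorem eval_ofPoly (r : ℂ[X]) {z : ℂ} (hz : z ∈ Metric.ball (0 : ℂ) 1) :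
    eval (ofPoly r) z = r.eval z := by
  rw [← evalCLM_apply hz, ofPoly, Polynomial.sum, map_sum, Polynomial.eval_eq_sum, Polynomial.sum]
  refine Finset.sum_congr rfl fun k _ => ?_
  rw [map_smul, evalCLM_apply, eval_monomial, smul_eq_mul]

theorem ofPoly_apply (r : ℂ[X]) (k : ℕ) : ofPoly r k = r.coeff k := by
  rw [← inner_monomial_left, ofPoly, Polynomial.sum, inner_sum]
  simp only [inner_smul_right, inner_monomial_left, monomial_apply]
  simp +contextual

theorem ofPoly_add (r s : ℂ[X]) : ofPoly (r + s) = ofPoly r + ofPoly s := by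
  ext k
  rw [lp.coeFn_add, Pi.add_apply, ofPoly_apply, ofPoly_apply, ofPoly_apply, Polynomial.coeff_add]

/-- An element of `H²` with finitely many nonzero coefficients is a polynomial. -/
theorem exists_ofPoly_eq {f : HardySpace} {N : ℕ} (h : ∀ k, N ≤ k → f k = 0) :
    ∃ r : ℂ[X], ofPoly r = f := by
  refine ⟨∑ k ∈ Finset.range N, Polynomial.monomial k (f k), ?_⟩
  ext k
  rw [ofPoly_apply, Polynomial.finsetSum_coeff]
  simp only [Polynomial.coeff_monomial, Finset.sum_ite_eq', Finset.mem_range]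
  split_ifs with hk
  · rfl
  · exact (h k (not_lt.mp hk)).symm

/-- `zᵐ H²` consists of the elements whose first `m` coefficients vanish. -/
theorem mem_range_Mz_pow_iff (m : ℕ) (f : HardySpace) :
    (∃ g, (Mz ^ m) g = f) ↔ ∀ k < m, f k = 0 := by
  constructor
  · rintro ⟨g, rfl⟩ k hk
    exact Mz_pow_apply_of_lt m g hk
  · intro h
    have hg : Memℓp (fun k => f (k + m)) 2 :=
      memℓp_gen (((lp.memℓp f).summable (by norm_num)).comp_injective (add_left_injective m))
    refine ⟨⟨_, hg⟩, ?_⟩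
    ext k
    by_cases hk : k < m
    · rw [Mz_pow_apply_of_lt _ _ hk, h k hk]
    · obtain ⟨j, rfl⟩ := Nat.exists_eq_add_of_le (not_lt.mp hk)
      rw [add_comm m j, Mz_pow_apply_add]

/-! ### Wandering vectors and the operators they multiply by -/

/-- `φ` is a unit vector orthogonal to `zᵏ φ` for all `k ≥ 1`. -/
structure IsWandering (φ : HardySpace) : Prop where
  norm_eq_one : ‖φ‖ = 1
  inner_pow_succ : ∀ k : ℕ, inner ℂ φ ((Mz ^ (k + 1)) φ) = 0

namespace IsWandering

variable {φ ψ : HardySpace}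

theorem inner_pow_pow_of_lt (hφ : IsWandering φ) {i j : ℕ} (h : i < j) :
    inner ℂ ((Mz ^ i) φ) ((Mz ^ j) φ) = 0 := by
  obtain ⟨k, rfl⟩ := Nat.exists_eq_add_of_lt h
  rw [add_assoc, pow_add, mul_apply_eq_comp, inner_Mz_pow_Mz_pow, hφ.inner_pow_succ]

theorem orthonormal (hφ : IsWandering φ) : Orthonormal ℂ fun k : ℕ => (Mz ^ k) φ := by
  refine ⟨fun k => ?_, fun i j hij => ?_⟩
  · exact ((MzPowIsometry k).norm_map φ).trans hφ.norm_eq_one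
  · rcases hij.lt_or_gt with h | h
    · exact hφ.inner_pow_pow_of_lt h
    · exact inner_eq_zero_symm.mp (hφ.inner_pow_pow_of_lt h)

/-- Multiplication by a wandering vector `φ`, `h ↦ ∑ₖ hₖ zᵏ φ`, as an isometry of `H²`. -/
noncomputable def mulOp (hφ : IsWandering φ) : HardySpace →ₗᵢ[ℂ] HardySpace :=
  hφ.orthonormal.orthogonalFamily.linearIsometry

theorem hasSum_mulOp (hφ : IsWandering φ) (h : HardySpace) :
    HasSum (fun k => h k • (Mz ^ k) φ) (hφ.mulOp h) :=
  hφ.orthonormal.orthogonalFamily.hasSum_linearIsometry h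

theorem eval_mulOp (hφ : IsWandering φ) (h : HardySpace) {z : ℂ}
    (hz : z ∈ Metric.ball (0 : ℂ) 1) : eval (hφ.mulOp h) z = eval φ z * eval h z := by
  have h1 := (evalCLM hz).hasSum (hφ.hasSum_mulOp h)
  refine h1.unique (((summable_eval h hz).hasSum.mul_left (eval φ z)).congr_fun fun k => ?_)
  rw [map_smul, evalCLM_apply, eval_Mz_pow _ _ hz, smul_eq_mul]
  ring

theorem mulOp_Mz_pow (hφ : IsWandering φ) (m : ℕ) (h : HardySpace) :
    hφ.mulOp ((Mz ^ m) h) = (Mz ^ m) (hφ.mulOp h) := by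
  refine ext_eval fun z hz => ?_
  rw [hφ.eval_mulOp _ hz, eval_Mz_pow _ _ hz, eval_Mz_pow _ _ hz, hφ.eval_mulOp _ hz]
  ring

theorem mulOp_monomial (hφ : IsWandering φ) (k : ℕ) : hφ.mulOp (monomial k) = (Mz ^ k) φ := by
  refine ext_eval fun z hz => ?_
  rw [hφ.eval_mulOp _ hz, eval_Mz_pow _ _ hz, eval_monomial, mul_comm]

theorem mulOp_comm (hφ : IsWandering φ) (hψ : IsWandering ψ) : hφ.mulOp ψ = hψ.mulOp φ := by
  refine ext_eval fun z hz => ?_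
  rw [hφ.eval_mulOp _ hz, hψ.eval_mulOp _ hz, mul_comm]

theorem mulOp_mem (hφ : IsWandering φ) {N : Submodule ℂ HardySpace}
    (hN : IsClosed (N : Set HardySpace)) (h : ∀ k : ℕ, (Mz ^ k) φ ∈ N) (f : HardySpace) :
    hφ.mulOp f ∈ N :=
  hN.mem_of_tendsto (hφ.hasSum_mulOp f)
    (Filter.Eventually.of_forall fun _ => N.sum_mem fun k _ => N.smul_mem _ (h k))

/-- Multiplication by `φ` is isometric, so `|φ(z)|ᵐ`, the value at `z` of the unit vector `φᵐ`, is
bounded in `m`; hence `|φ(z)| ≤ 1`. -/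
theorem norm_eval_le_one (hφ : IsWandering φ) {z : ℂ} (hz : z ∈ Metric.ball (0 : ℂ) 1) :
    ‖eval φ z‖ ≤ 1 := by
  by_contra! hlt
  obtain ⟨m, hm⟩ := pow_unbounded_of_one_lt ((1 - ‖z‖)⁻¹) hlt
  have key : ∀ m : ℕ, ∃ g : HardySpace, ‖g‖ = 1 ∧ eval g z = eval φ z ^ m := by
    intro m
    induction m with
    | zero => exact ⟨monomial 0, by simp [monomial], by simp [eval_monomial]⟩
    | succ m ih =>
      obtain ⟨g, hg, hgz⟩ := ih
      refine ⟨hφ.mulOp g, by rw [LinearIsometry.norm_map, hg], ?_⟩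
      rw [hφ.eval_mulOp _ hz, hgz, pow_succ']
  obtain ⟨g, hg, hgz⟩ := key m
  have := norm_eval_le g hz
  rw [hg, hgz, norm_pow, mul_one] at this
  linarith

end IsWandering

/-! ### Unimodularity of the boundary function -/

/-- The boundary map is an isometry. -/
theorem inner_boundary (f g : HardySpace) : inner ℂ (boundary f) (boundary g) = inner ℂ f g := by
  have ho : Orthonormal ℂ fun k : ℕ => fourierLp (T := (1 : ℝ)) 2 (k : ℤ) :=
    orthonormal_fourier.comp _ Nat.cast_injective
  exact ho.orthogonalFamily.linearIsometry.inner_map_map f g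

/-- On the circle, the shift acts as multiplication by the first Fourier character. -/
theorem boundary_Mz_pow (m : ℕ) (f : HardySpace) :
    boundary ((Mz ^ m) f) =ᵐ[AddCircle.haarAddCircle (T := (1 : ℝ))]
      fun t => fourier (m : ℤ) t * boundary f t := by
  -- `U` is multiplication by the bounded function `fourier m`, as an operator on `L²`.
  let U := (ContinuousLinearMap.mul ℂ ℂ).holderL
    (AddCircle.haarAddCircle (T := (1 : ℝ))) ∞ 2 2 (fourierLp ∞ (m : ℤ))
  have hU : ∀ g, U g =ᵐ[AddCircle.haarAddCircle (T := (1 : ℝ))]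
      fun t => fourier (m : ℤ) t * g t := by
    intro g
    have h1 := (ContinuousLinearMap.mul ℂ ℂ).coeFn_holder (r := 2)
      (fourierLp (T := (1 : ℝ)) ∞ (m : ℤ)) g
    filter_upwards [h1, coeFn_fourierLp (T := (1 : ℝ)) ∞ (m : ℤ)] with t h1 h2
    rw [← h2]
    exact h1
  have hUf : ∀ k : ℤ, U (fourierLp 2 k) = fourierLp 2 (k + m) := by
    intro k
    refine Lp.ext ?_
    filter_upwards [hU (fourierLp 2 k), coeFn_fourierLp (T := (1 : ℝ)) 2 k,
      coeFn_fourierLp (T := (1 : ℝ)) 2 (k + m)] with t h1 h2 h3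
    rw [h1, h2, h3, fourier_add, mul_comm]
  have hUb : U (boundary f) = boundary ((Mz ^ m) f) := by
    have h1 := U.hasSum (hasSum_boundary f)
    have h2 := (hasSum_nat_add_iff' m).mpr (hasSum_boundary ((Mz ^ m) f))
    rw [Finset.sum_eq_zero, sub_zero] at h2
    · refine h1.unique (h2.congr_fun fun k => ?_)
      rw [map_smul, hUf, Mz_pow_apply_add, Nat.cast_add]
    · intro k hk
      rw [Mz_pow_apply_of_lt _ _ (Finset.mem_range.mp hk), zero_smul]
  rw [← hUb]
  exact hU _

/-- A finite measure on the circle is determined by its Fourier coefficients. -/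
theorem measure_ext_of_integral_fourier {T : ℝ} [Fact (0 < T)] {μ ν : Measure (AddCircle T)}
    [IsFiniteMeasure μ] [IsFiniteMeasure ν]
    (h : ∀ k : ℤ, ∫ t, fourier k t ∂μ = ∫ t, fourier k t ∂ν) : μ = ν := by
  let A : StarSubalgebra ℂ (BoundedContinuousFunction (AddCircle T) ℂ) :=
    fourierSubalgebra.comap (BoundedContinuousFunction.toContinuousMapStarₐ ℂ)
  refine ext_of_forall_mem_subalgebra_integral_eq_of_polish (A := A) ?_ ?_
  · intro x y hxy
    obtain ⟨_, ⟨g, hg, rfl⟩, hne⟩ := fourierSubalgebra_separatesPoints hxy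
    exact ⟨g, ⟨g, ⟨BoundedContinuousFunction.mkOfCompact g, hg, rfl⟩, rfl⟩, hne⟩
  · intro g hg
    have hint : ∀ (ρ : Measure (AddCircle T)) [IsFiniteMeasure ρ] (g : C(AddCircle T, ℂ)),
        Integrable g ρ := fun ρ _ g =>
      (BoundedContinuousFunction.mkOfCompact g).integrable ρ
    have hg' : (g : C(AddCircle T, ℂ)) ∈ Submodule.span ℂ (Set.range (@fourier T)) := by
      rw [← fourierSubalgebra_coe]
      exact hg
    change ∫ x, (g : C(AddCircle T, ℂ)) x ∂μ = ∫ x, (g : C(AddCircle T, ℂ)) x ∂ν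
    generalize (g : C(AddCircle T, ℂ)) = g' at hg'
    induction hg' using Submodule.span_induction with
    | mem x hx =>
      obtain ⟨k, rfl⟩ := hx
      exact h k
    | zero => simp
    | add x y _ _ hx hy =>
      simp only [ContinuousMap.add_apply]
      rw [integral_add (hint _ _) (hint _ _), integral_add (hint _ _) (hint _ _), hx, hy]
    | smul c x _ hx =>
      simp only [ContinuousMap.smul_apply]
      rw [integral_smul, integral_smul, hx]

/-- If `|f|² dt` and `dt` have the same Fourier coefficients, then `|f| = 1` almost everywhere: the
two measures agree, hence so do their densities. -/
theorem ae_norm_eq_one_of_integral_fourier {f : Lp ℂ 2 (AddCircle.haarAddCircle (T := (1 : ℝ)))}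
    (h : ∀ k : ℤ, ∫ t, (((‖f t‖ ^ 2 : ℝ) : ℂ) * fourier k t) ∂AddCircle.haarAddCircle =
      ∫ t, fourier k t ∂(AddCircle.haarAddCircle (T := (1 : ℝ)))) :
    ∀ᵐ t ∂(AddCircle.haarAddCircle (T := (1 : ℝ))), ‖f t‖ = 1 := by
  let μ := AddCircle.haarAddCircle (T := (1 : ℝ))
  have hmeas : AEMeasurable (fun t => ENNReal.ofReal (‖f t‖ ^ 2)) μ :=
    ((Lp.aestronglyMeasurable f).norm.aemeasurable.pow_const 2).ennreal_ofReal
  have hint : Integrable (fun t => ‖f t‖ ^ 2) μ := (Lp.memLp f).integrable_norm_pow (by norm_num)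
  have hfin : IsFiniteMeasure (μ.withDensity fun t => ENNReal.ofReal (‖f t‖ ^ 2)) :=
    isFiniteMeasure_withDensity_ofReal hint.2
  have heq : μ.withDensity (fun t => ENNReal.ofReal (‖f t‖ ^ 2)) = μ := by
    refine measure_ext_of_integral_fourier fun k => ?_
    rw [integral_withDensity_eq_integral_toReal_smul₀ hmeas
      (Filter.Eventually.of_forall fun t => ENNReal.ofReal_lt_top), ← h k]
    refine integral_congr_ae (Filter.Eventually.of_forall fun t => ?_)
    simp only
    rw [ENNReal.toReal_ofReal (by positivity), Complex.real_smul]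
  have h1 : (fun t => ENNReal.ofReal (‖f t‖ ^ 2)) =ᵐ[μ] 1 :=
    (withDensity_eq_iff_of_sigmaFinite hmeas aemeasurable_one).mp
      (heq.trans withDensity_one.symm)
  filter_upwards [h1] with t ht
  rwa [Pi.one_apply, ENNReal.ofReal_eq_one,
    pow_eq_one_iff_of_nonneg (norm_nonneg _) two_ne_zero] at ht

theorem IsWandering.isInner {φ : HardySpace} (hφ : IsWandering φ) : IsInner (eval φ) := by
  refine ⟨analyticOnNhd_eval φ, ⟨1, fun z hz => hφ.norm_eval_le_one hz⟩, φ, fun z _ => rfl, ?_⟩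
  -- The `k`-th moment of `|φ|²` is `⟨φ, zᵏ φ⟩` for `k ≥ 0`.
  have hnat : ∀ k : ℕ, ∫ t, (((‖boundary φ t‖ ^ 2 : ℝ) : ℂ) * fourier (k : ℤ) t)
      ∂(AddCircle.haarAddCircle (T := (1 : ℝ))) = if k = 0 then 1 else 0 := by
    intro k
    have h1 := inner_boundary φ ((Mz ^ k) φ)
    rw [L2.inner_def] at h1
    have h2 : inner ℂ φ ((Mz ^ k) φ) = if k = 0 then 1 else 0 := by
      cases k with
      | zero => simp [inner_self_eq_norm_sq_to_K, hφ.norm_eq_one]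
      | succ k => simpa using hφ.inner_pow_succ k
    rw [← h2, ← h1]
    refine integral_congr_ae ?_
    filter_upwards [boundary_Mz_pow k φ] with t ht
    rw [ht, RCLike.inner_apply, mul_assoc, Complex.mul_conj, Complex.normSq_eq_norm_sq, mul_comm]
  have hone : ∀ k : ℤ, ∫ t, fourier k t ∂(AddCircle.haarAddCircle (T := (1 : ℝ))) =
      if k = 0 then 1 else 0 := by
    intro k
    have h1 := orthonormal_iff_ite.mp (orthonormal_fourier (T := (1 : ℝ))) 0 k
    rw [L2.inner_def] at h1
    simp only [eq_comm (a := (0 : ℤ))] at h1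
    rw [← h1]
    refine integral_congr_ae ?_
    filter_upwards [coeFn_fourierLp (T := (1 : ℝ)) 2 k,
      coeFn_fourierLp (T := (1 : ℝ)) 2 0] with t h2 h3
    rw [h2, h3, RCLike.inner_apply, fourier_zero]
    simp
  refine ae_norm_eq_one_of_integral_fourier fun k => ?_
  rw [hone]
  obtain ⟨m, rfl | rfl⟩ := k.eq_nat_or_neg
  · rw [hnat]
    simp
  -- `|φ|²` is real, so its Fourier coefficients at `m` and `-m` are conjugate.
  · have h1 := congrArg (starRingEnd ℂ) (hnat m)
    rw [← integral_conj] at h1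
    simp only [map_mul, Complex.conj_ofReal, ← fourier_neg] at h1
    rw [h1]
    split_ifs <;> simp_all

/-! ### Wandering subspaces and Beurling's theorem -/

/-- `T` maps `zᵐ H²` into `zᵐ⁺¹ H²` for every `m`. -/
def RaisesOrder (T : HardySpace →L[ℂ] HardySpace) : Prop :=
  ∀ (m : ℕ) (f : HardySpace), (∀ k < m, f k = 0) → ∀ k < m + 1, T f k = 0

theorem raisesOrder_Mz : RaisesOrder Mz := by
  intro m f hf k hk
  cases k with
  | zero => rfl
  | succ k => rw [Mz_apply_succ, hf k (by omega)]

theorem RaisesOrder.pow_apply {T : HardySpace →L[ℂ] HardySpace} (hT : RaisesOrder T) (m : ℕ)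
    (f : HardySpace) : ∀ k < m, (T ^ m) f k = 0 := by
  induction m with
  | zero => intro k hk; omega
  | succ m ih => rw [pow_succ', mul_apply_eq_comp]; exact hT m _ ih

/-- If `M ⊆ T M`, every element of `M` lies in `zᵐ H²` for all `m`. -/
theorem RaisesOrder.eq_bot_of_le_map {T : HardySpace →L[ℂ] HardySpace} (hT : RaisesOrder T)
    {M : Submodule ℂ HardySpace} (h : ∀ f ∈ M, ∃ g ∈ M, T g = f) : M = ⊥ := by
  have key : ∀ m : ℕ, ∀ f ∈ M, ∀ k < m, f k = 0 := by
    intro m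
    induction m with
    | zero => intro f _ k hk; omega
    | succ m ih =>
      intro f hf
      obtain ⟨g, hg, rfl⟩ := h f hf
      exact hT m g (ih g hg)
  refine (Submodule.eq_bot_iff M).mpr fun f hf => ?_
  ext k
  exact key (k + 1) f hf k (Nat.lt_succ_self k)

/-- The wandering subspace `M ⊖ T M` contains a unit vector. -/
theorem RaisesOrder.exists_unit_orthogonal {T : HardySpace →L[ℂ] HardySpace} (hT : RaisesOrder T)
    (hTc : Topology.IsClosedEmbedding T) {M : Submodule ℂ HardySpace}
    (hMc : IsClosed (M : Set HardySpace)) (hM : M ≠ ⊥) (hinv : ∀ f ∈ M, T f ∈ M) :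
    ∃ φ ∈ M, ‖φ‖ = 1 ∧ ∀ g ∈ M, inner ℂ φ (T g) = 0 := by
  let K : Submodule ℂ HardySpace := M.map T.toLinearMap
  have hKc : IsClosed (K : Set HardySpace) := hTc.isClosedMap _ hMc
  have : CompleteSpace K := hKc.completeSpace_coe
  have hKM : K ≤ M := by
    rintro _ ⟨g, hg, rfl⟩
    exact hinv g hg
  obtain ⟨f, hf, hfK⟩ : ∃ f ∈ M, f ∉ K := by
    by_contra! h
    exact hM (hT.eq_bot_of_le_map h)
  let u := f - K.starProjection f
  have huK : u ∈ Kᗮ := K.sub_starProjection_mem_orthogonal f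
  have huM : u ∈ M := M.sub_mem hf (hKM (K.starProjection_apply_mem f))
  have hu : u ≠ 0 := by
    intro h
    rw [sub_eq_zero] at h
    exact hfK (h ▸ K.starProjection_apply_mem f)
  refine ⟨((‖u‖ : ℂ)⁻¹) • u, M.smul_mem _ huM, norm_smul_inv_norm hu, fun g hg => ?_⟩
  have h0 : inner ℂ u (T g) = 0 := (K.mem_orthogonal' u).mp huK _ ⟨g, hg, rfl⟩
  rw [inner_smul_left, h0, mul_zero]

theorem isClosedEmbedding_Mz_pow (m : ℕ) :
    Topology.IsClosedEmbedding (Mz ^ m : HardySpace →L[ℂ] HardySpace) :=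
  (MzPowIsometry m).isometry.isClosedEmbedding

/-- Unit vectors of `N ⊖ z N` are wandering vectors. -/
theorem exists_isWandering {N : Submodule ℂ HardySpace} (hNc : IsClosed (N : Set HardySpace))
    (hN : N ≠ ⊥) (hinv : ∀ f ∈ N, Mz f ∈ N) :
    ∃ φ ∈ N, IsWandering φ ∧ (∀ k : ℕ, (Mz ^ k) φ ∈ N) ∧ ∀ g ∈ N, inner ℂ φ (Mz g) = 0 := by
  have hc : Topology.IsClosedEmbedding Mz := by simpa using isClosedEmbedding_Mz_pow 1
  obtain ⟨φ, hφN, h1, h2⟩ := raisesOrder_Mz.exists_unit_orthogonal hc hNc hN hinv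
  have hpow : ∀ k : ℕ, (Mz ^ k) φ ∈ N := by
    intro k
    induction k with
    | zero => exact hφN
    | succ k ih => rw [pow_succ', mul_apply_eq_comp]; exact hinv _ ih
  refine ⟨φ, hφN, ⟨h1, fun k => ?_⟩, hpow, h2⟩
  rw [pow_succ', mul_apply_eq_comp]
  exact h2 _ (hpow k)

/-- **Beurling's theorem**: a nonzero closed `M_z`-invariant subspace is `θ H²` for a
wandering vector `θ`. The orthogonal complement of `θ H²` in the subspace is again
invariant; if it contained a wandering vector `ψ`, then `θ ψ` would lie in both. -/
theorem exists_eq_range_mulOp {N : Submodule ℂ HardySpace} (hNc : IsClosed (N : Set HardySpace))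
    (hN : N ≠ ⊥) (hinv : ∀ f ∈ N, Mz f ∈ N) :
    ∃ (φ : HardySpace) (hφ : IsWandering φ), ∀ g, g ∈ N ↔ ∃ h, hφ.mulOp h = g := by
  obtain ⟨φ, hφN, hφ, hpow, hperp⟩ := exists_isWandering hNc hN hinv
  refine ⟨φ, hφ, fun g => ⟨fun hg => ?_, ?_⟩⟩
  swap
  · rintro ⟨h, rfl⟩
    exact hφ.mulOp_mem hNc hpow h
  let R : Submodule ℂ HardySpace := LinearMap.range hφ.mulOp.toLinearMap
  have hRc : IsClosed (R : Set HardySpace) := hφ.mulOp.isometry.isClosedEmbedding.isClosed_range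
  have : CompleteSpace R := hRc.completeSpace_coe
  have hRN : R ≤ N := by
    rintro _ ⟨h, rfl⟩
    exact hφ.mulOp_mem hNc hpow h
  have hK : N ⊓ Rᗮ = ⊥ := by
    by_contra hne
    have hKc : IsClosed ((N ⊓ Rᗮ : Submodule ℂ HardySpace) : Set HardySpace) :=
      hNc.inter R.isClosed_orthogonal
    have hKinv : ∀ f ∈ N ⊓ Rᗮ, Mz f ∈ N ⊓ Rᗮ := by
      rintro f ⟨hfN, hfR⟩
      refine ⟨hinv f hfN, (Submodule.mem_orthogonal _ _).mpr ?_⟩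
      rintro _ ⟨h, rfl⟩
      change inner ℂ (hφ.mulOp h) (Mz f) = 0
      -- `z f` is orthogonal to every `zᵏ φ`: for `k = 0` because `φ ⟂ z N`, otherwise because
      -- `f` is orthogonal to `zᵏ⁻¹ φ`.
      have hmem : ∀ h, hφ.mulOp h ∈ (Submodule.span ℂ {Mz f})ᗮ := by
        refine hφ.mulOp_mem (Submodule.isClosed_orthogonal _) fun k => ?_
        rw [Submodule.mem_orthogonal_singleton_iff_inner_left]
        cases k with
        | zero => exact hperp f hfN
        | succ k =>
          rw [pow_succ', mul_apply_eq_comp, inner_Mz_Mz, ← hφ.mulOp_monomial]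
          exact (Submodule.mem_orthogonal _ _).mp hfR _ ⟨_, rfl⟩
      exact Submodule.mem_orthogonal_singleton_iff_inner_left.mp (hmem h)
    obtain ⟨ψ, hψK, hψ, hψpow, -⟩ := exists_isWandering hKc hne hKinv
    have h1 : hψ.mulOp φ ∈ N ⊓ Rᗮ := hψ.mulOp_mem hKc hψpow φ
    have h2 : inner ℂ (hψ.mulOp φ) (hψ.mulOp φ) = 0 :=
      (Submodule.mem_orthogonal _ _).mp h1.2 _ ⟨ψ, hφ.mulOp_comm hψ⟩
    rw [LinearIsometry.inner_map_map, inner_self_eq_zero] at h2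
    simpa [h2] using hφ.norm_eq_one
  have hu : g - R.starProjection g ∈ N ⊓ Rᗮ :=
    ⟨N.sub_mem hg (hRN (R.starProjection_apply_mem g)), R.sub_starProjection_mem_orthogonal g⟩
  rw [hK, Submodule.mem_bot, sub_eq_zero] at hu
  obtain ⟨h, hh⟩ := R.starProjection_apply_mem g
  exact ⟨h, hh.trans hu.symm⟩

theorem IsWandering.mem_multRange_iff {φ : HardySpace} (hφ : IsWandering φ) (n : ℕ)
    (g : HardySpace) : g ∈ multRange n (eval φ) ↔ ∃ h, (Mz ^ n) (hφ.mulOp h) = g := by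
  constructor
  · rintro ⟨h, hh⟩
    refine ⟨h, ext_eval fun z hz => ?_⟩
    rw [eval_Mz_pow _ _ hz, hφ.eval_mulOp _ hz, hh z hz, mul_assoc]
  · rintro ⟨h, rfl⟩
    refine ⟨h, fun z hz => ?_⟩
    rw [eval_Mz_pow _ _ hz, hφ.eval_mulOp _ hz, mul_assoc]

/-! ### Perturbations of the shift -/

namespace IsPerturbation

variable {n : ℕ} {F : HardySpace →L[ℂ] HardySpace}

theorem exists_apply_eq (hF : IsPerturbation n F) (m : ℕ) (f : HardySpace) :
    ∃ r : ℂ[X], F ((Mz ^ m) f) = (Mz ^ (m + 1)) (ofPoly r) := by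
  obtain ⟨r, hr⟩ := hF.map_range m f
  refine ⟨r, ext_eval fun z hz => ?_⟩
  rw [hr z hz, eval_Mz_pow _ _ hz, eval_ofPoly _ hz]

theorem apply_Mz_pow (hF : IsPerturbation n F) (f : HardySpace) : F ((Mz ^ n) f) = 0 := by
  have h := (F ∘L (Mz ^ n)).hasSum (hasSum_monomial f)
  refine h.unique (hasSum_zero.congr_fun fun k => ?_)
  rw [ContinuousLinearMap.comp_apply, map_smul, Mz_pow_monomial, map_smul,
    hF.map_monomial _ (Nat.le_add_left n k), smul_zero]

/-- `M_z + F` agrees with `M_z` on `zⁿ H²`. -/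
theorem add_apply_Mz_pow (hF : IsPerturbation n F) (f : HardySpace) :
    (Mz + F) ((Mz ^ n) f) = (Mz ^ n) (Mz f) := by
  rw [add_apply, hF.apply_Mz_pow, add_zero, ← mul_apply_eq_comp,
    ← mul_apply_eq_comp, pow_mul_comm']

theorem raisesOrder (hF : IsPerturbation n F) : RaisesOrder (Mz + F) := by
  intro m f hf k hk
  obtain ⟨g, rfl⟩ := (mem_range_Mz_pow_iff m f).mpr hf
  obtain ⟨r, hr⟩ := hF.exists_apply_eq m g
  rw [add_apply, hr, lp.coeFn_add, Pi.add_apply,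
    raisesOrder_Mz m _ hf k hk, Mz_pow_apply_of_lt _ _ hk, add_zero]

theorem isClosedEmbedding_pow (hF : IsPerturbation n F) (i : ℕ) :
    Topology.IsClosedEmbedding ((Mz + F) ^ i) := by
  obtain ⟨L, hL⟩ := hF.left_invertible
  have h : (L ^ i) * (Mz + F) ^ i = 1 := pow_mul_pow_eq_one i hL
  exact Function.LeftInverse.isClosedEmbedding (f := L ^ i)
    (fun f => DFunLike.congr_fun h f) (L ^ i).continuous ((Mz + F) ^ i).continuous

theorem injective (hF : IsPerturbation n F) : Function.Injective (Mz + F) := by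
  simpa using (hF.isClosedEmbedding_pow 1).injective

/-- `(M_z + F)ᵏ f` differs from `zᵏ f` by an element of `zᵏ ℂ[z]`. -/
theorem exists_pow_apply_eq (hF : IsPerturbation n F) (k : ℕ) (f : HardySpace) :
    ∃ r : ℂ[X], ((Mz + F) ^ k) f = (Mz ^ k) (f + ofPoly r) := by
  induction k with
  | zero => exact ⟨0, by simp [ofPoly]⟩
  | succ k ih =>
    obtain ⟨r, hr⟩ := ih
    obtain ⟨s, hs⟩ := hF.exists_apply_eq k (f + ofPoly r)
    refine ⟨r + s, ?_⟩
    rw [pow_succ', mul_apply_eq_comp, hr, add_apply, hs, ← mul_apply_eq_comp,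
      ← pow_succ', ← map_add, ofPoly_add, add_assoc]

/-- A nonzero closed invariant subspace contained in `zⁿ H²` is of the form `zⁿ θ H²`, by Beurling's
theorem. -/
theorem exists_eq_multRange (hF : IsPerturbation n F) {K : Submodule ℂ HardySpace}
    (hKc : IsClosed (K : Set HardySpace)) (hK : K ≠ ⊥) (hinv : ∀ f ∈ K, (Mz + F) f ∈ K)
    (hord : ∀ f ∈ K, ∀ k < n, f k = 0) :
    ∃ φ : HardySpace, IsWandering φ ∧ K = multRange n (eval φ) := by
  let N : Submodule ℂ HardySpace := K.comap (Mz ^ n).toLinearMap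
  have hNc : IsClosed (N : Set HardySpace) := hKc.preimage (Mz ^ n).continuous
  have hN : N ≠ ⊥ := by
    obtain ⟨f, hf, hf0⟩ := Submodule.exists_mem_ne_zero_of_ne_bot hK
    obtain ⟨g, rfl⟩ := (mem_range_Mz_pow_iff n f).mpr (hord f hf)
    exact (Submodule.ne_bot_iff N).mpr ⟨g, hf, fun h => hf0 (by rw [h, map_zero])⟩
  have hNinv : ∀ f ∈ N, Mz f ∈ N := by
    intro f hf
    have := hinv _ hf
    change (Mz ^ n) (Mz f) ∈ K
    rw [← hF.add_apply_Mz_pow]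
    exact this
  obtain ⟨φ, hφ, hmem⟩ := exists_eq_range_mulOp hNc hN hNinv
  refine ⟨φ, hφ, ?_⟩
  ext f
  rw [hφ.mem_multRange_iff]
  constructor
  · intro hf
    obtain ⟨g, rfl⟩ := (mem_range_Mz_pow_iff n f).mpr (hord f hf)
    obtain ⟨h, rfl⟩ := (hmem g).mp hf
    exact ⟨h, rfl⟩
  · rintro ⟨h, rfl⟩
    exact (hmem _).mpr ⟨h, rfl⟩

/-- An invariant subspace `M` has `dim M / (M_z + F) M ≤ 1`. The same bound holds for each
`M ∩ zᵏ H²`; it is proved downwards from `k = n`, where it follows from Beurling's theorem. -/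
theorem exists_generator (hF : IsPerturbation n F) {M : Submodule ℂ HardySpace}
    (hMc : IsClosed (M : Set HardySpace)) (hinv : ∀ f ∈ M, (Mz + F) f ∈ M) :
    ∃ g : HardySpace, ∀ f ∈ M, ∃ (c : ℂ), ∃ h ∈ M, f = c • g + (Mz + F) h := by
  -- `V k = M ∩ zᵏ H²`
  let V (k : ℕ) : Submodule ℂ HardySpace := M ⊓ LinearMap.range (Mz ^ k).toLinearMap
  have hV : ∀ k f, f ∈ V k ↔ f ∈ M ∧ ∀ j < k, f j = 0 := fun k f =>
    and_congr_right fun _ => mem_range_Mz_pow_iff k f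
  have hVS : ∀ k, ∀ f ∈ V k, (Mz + F) f ∈ V (k + 1) := by
    intro k f hf
    rw [hV] at hf ⊢
    exact ⟨hinv f hf.1, hF.raisesOrder k f hf.2⟩
  have hVle : ∀ k, V (k + 1) ≤ V k := by
    intro k f hf
    rw [hV] at hf ⊢
    exact ⟨hf.1, fun j hj => hf.2 j (by omega)⟩
  have key : ∀ k ≤ n, ∃ g : HardySpace, ∀ f ∈ V k, ∃ (c : ℂ), ∃ h ∈ V k,
      f = c • g + (Mz + F) h := by
    intro k hk
    induction hk using Nat.decreasingInduction with
    | self =>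
      by_cases hbot : V n = ⊥
      · refine ⟨0, fun f hf => ⟨0, 0, zero_mem _, ?_⟩⟩
        rw [hbot, Submodule.mem_bot] at hf
        simp [hf]
      have hVc : IsClosed (V n : Set HardySpace) :=
        hMc.inter (isClosedEmbedding_Mz_pow n).isClosed_range
      obtain ⟨φ, hφ, heq⟩ := hF.exists_eq_multRange hVc hbot (fun f hf => hVle n (hVS n f hf))
        (fun f hf => ((hV n f).mp hf).2)
      refine ⟨(Mz ^ n) φ, fun f hf => ?_⟩
      rw [heq, hφ.mem_multRange_iff] at hf
      obtain ⟨h, rfl⟩ := hf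
      -- `h = h(0) + z u`, so `zⁿ φ h = h(0) zⁿ φ + z (zⁿ φ u)`
      obtain ⟨u, hu⟩ := (mem_range_Mz_pow_iff 1 (h - h 0 • monomial 0)).mpr (by
        intro k hk
        obtain rfl : k = 0 := by omega
        rw [lp.coeFn_sub, Pi.sub_apply, lp.coeFn_smul, Pi.smul_apply, monomial_apply, if_pos rfl,
          smul_eq_mul, mul_one, sub_self])
      refine ⟨h 0, (Mz ^ n) (hφ.mulOp u), ?_, ?_⟩
      · rw [heq, hφ.mem_multRange_iff]
        exact ⟨u, rfl⟩
      · have hh : h = h 0 • monomial 0 + (Mz ^ 1) u := by rw [hu]; abel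
        rw [hF.add_apply_Mz_pow]
        conv_lhs => rw [hh]
        rw [map_add, map_smul, hφ.mulOp_monomial, hφ.mulOp_Mz_pow, map_add, map_smul]
        simp
    | of_succ k hk ih =>
      obtain ⟨g, hg⟩ := ih
      by_cases hle : V k ≤ V (k + 1)
      · refine ⟨g, fun f hf => ?_⟩
        obtain ⟨c, h, hh, hf⟩ := hg f (hle hf)
        exact ⟨c, h, hVle k hh, hf⟩
      obtain ⟨f₀, hf₀, hf₀'⟩ := SetLike.not_le_iff_exists.mp hle
      have hne : f₀ k ≠ 0 := by
        intro h0
        refine hf₀' ((hV _ _).mpr ⟨hf₀.1, fun j hj => ?_⟩)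
        rcases Nat.lt_succ_iff_lt_or_eq.mp hj with h | rfl
        · exact ((hV _ _).mp hf₀).2 j h
        · exact h0
      obtain ⟨c, h, hh, hc⟩ := hg _ (hVS k f₀ hf₀)
      -- injectivity of `M_z + F` makes `(M_z + F) f₀` a generator for `V (k + 1)`
      have hc0 : c ≠ 0 := by
        rintro rfl
        rw [zero_smul, zero_add] at hc
        exact hf₀' (hF.injective hc ▸ hh)
      have hg' : g = c⁻¹ • (Mz + F) (f₀ - h) := by
        rw [map_sub, hc, add_sub_cancel_right, inv_smul_smul₀ hc0]
      refine ⟨f₀, fun f hf => ?_⟩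
      have hd : f - (f k / f₀ k) • f₀ ∈ V (k + 1) := by
        have hd' : f - (f k / f₀ k) • f₀ ∈ V k := sub_mem hf (Submodule.smul_mem _ _ hf₀)
        refine (hV _ _).mpr ⟨hd'.1, fun j hj => ?_⟩
        rcases Nat.lt_succ_iff_lt_or_eq.mp hj with h | rfl
        · exact ((hV _ _).mp hd').2 j h
        · rw [lp.coeFn_sub, Pi.sub_apply, lp.coeFn_smul, Pi.smul_apply, smul_eq_mul,
            div_mul_cancel₀ _ hne, sub_self]
      obtain ⟨d, h', hh', hd⟩ := hg _ hd
      refine ⟨f k / f₀ k, d • c⁻¹ • (f₀ - h) + h', ?_, ?_⟩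
      · exact add_mem (Submodule.smul_mem _ _ (Submodule.smul_mem _ _
          (sub_mem hf₀ (hVle k hh)))) (hVle k hh')
      · rw [sub_eq_iff_eq_add', hg'] at hd
        rw [map_add, map_smul, map_smul]
        exact hd
  obtain ⟨g, hg⟩ := key 0 (Nat.zero_le n)
  refine ⟨g, fun f hf => ?_⟩
  obtain ⟨c, h, hh, hf⟩ := hg f ((hV _ _).mpr ⟨hf, fun j hj => by omega⟩)
  exact ⟨c, h, hh.1, hf⟩

/-- For a nonzero closed invariant subspace `M`, the space `M ⊖ (M_z + F) M` is one-dimensional. -/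
theorem exists_unit_generator (hF : IsPerturbation n F) {M : Submodule ℂ HardySpace}
    (hMc : IsClosed (M : Set HardySpace)) (hM : M ≠ ⊥) (hinv : ∀ f ∈ M, (Mz + F) f ∈ M) :
    ∃ φ ∈ M, ‖φ‖ = 1 ∧ (∀ g ∈ M, inner ℂ φ ((Mz + F) g) = 0) ∧
      ∀ f ∈ M, ∃ (c : ℂ), ∃ h ∈ M, f = c • φ + (Mz + F) h := by
  have hc : Topology.IsClosedEmbedding (Mz + F) := by simpa using hF.isClosedEmbedding_pow 1
  obtain ⟨φ, hφM, h1, h2⟩ := hF.raisesOrder.exists_unit_orthogonal hc hMc hM hinv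
  refine ⟨φ, hφM, h1, h2, fun f hf => ?_⟩
  obtain ⟨g, hg⟩ := hF.exists_generator hMc hinv
  obtain ⟨a, u, hu, hφ⟩ := hg φ hφM
  obtain ⟨b, v, hv, hf'⟩ := hg f hf
  have ha : a ≠ 0 := by
    rintro rfl
    rw [zero_smul, zero_add] at hφ
    have h3 := h2 u hu
    rw [← hφ, inner_self_eq_zero] at h3
    simp [h3] at h1
  refine ⟨b / a, v - (b / a) • u, M.sub_mem hv (M.smul_mem _ hu), ?_⟩
  conv_rhs => rw [hφ]
  rw [map_sub, map_smul, smul_add, smul_smul, div_mul_cancel₀ _ ha, hf']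
  abel

end IsPerturbation

/-! ### The two directions of the representation theorem -/

/-- If `g(z) = zᵐ w(z)` on the punctured disc with `w` continuous at `0`, then `g ∈ zᵐ H²`. -/
theorem exists_Mz_pow_eq_of_eval_eq {w : ℂ → ℂ} (hw : ContinuousAt w 0) (m : ℕ) (g : HardySpace)
    (hg : ∀ z ∈ Metric.ball (0 : ℂ) 1, z ≠ 0 → eval g z = z ^ m * w z) :
    ∃ g', (Mz ^ m) g' = g := by
  induction m generalizing g with
  | zero => exact ⟨g, rfl⟩
  | succ m ih =>
    have hcont : ContinuousAt (eval g) 0 :=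
      (analyticOnNhd_eval g 0 (Metric.mem_ball_self one_pos)).continuousAt
    have hev : eval g =ᶠ[nhdsWithin 0 {0}ᶜ] fun z => z ^ (m + 1) * w z := by
      filter_upwards [self_mem_nhdsWithin,
        mem_nhdsWithin_of_mem_nhds (Metric.ball_mem_nhds (0 : ℂ) one_pos)] with z h1 h2
      exact hg z h2 h1
    have h0 : eval g 0 = 0 := by
      have := ((hcont.eventuallyEq_nhds_iff_eventuallyEq_nhdsNE
        (by fun_prop)).mp hev).eq_of_nhds
      simpa using this
    have hg0 : g 0 = 0 := by
      rw [eval, tsum_eq_single 0 (fun k hk => by simp [hk])] at h0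
      simpa using h0
    obtain ⟨g₁, rfl⟩ := (mem_range_Mz_pow_iff 1 g).mpr fun k hk => by
      obtain rfl : k = 0 := by omega
      exact hg0
    obtain ⟨g', rfl⟩ := ih g₁ fun z hz hz0 => by
      have := hg z hz hz0
      rw [eval_Mz_pow _ _ hz, pow_one, pow_succ', mul_assoc] at this
      exact mul_left_cancel₀ hz0 this
    exact ⟨g', by rw [pow_succ', pow_one, mul_apply_eq_comp]⟩

namespace IsPerturbation

variable {n : ℕ} {F : HardySpace →L[ℂ] HardySpace} {M : Submodule ℂ HardySpace}

theorem map_mem_multRange (hF : IsPerturbation n F) {θ : ℂ → ℂ} (hθ : IsInner θ)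
    {g : HardySpace} (hg : g ∈ multRange n θ) : (Mz + F) g ∈ multRange n θ := by
  obtain ⟨h, hh⟩ := hg
  have h0 : (0 : ℂ) ∈ Metric.ball (0 : ℂ) 1 := Metric.mem_ball_self one_pos
  obtain ⟨g', rfl⟩ := exists_Mz_pow_eq_of_eval_eq (w := fun z => θ z * eval h z)
    ((hθ.analytic 0 h0).continuousAt.mul (analyticOnNhd_eval h 0 h0).continuousAt) n g
    fun z hz _ => by rw [hh z hz, mul_assoc]
  refine ⟨Mz h, fun z hz => ?_⟩
  rw [hF.add_apply_Mz_pow, eval_Mz_pow _ _ hz, eval_Mz _ hz, eval_Mz _ hz]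
  have hh' := hh z hz
  rw [eval_Mz_pow _ _ hz] at hh'
  linear_combination z * hh'

theorem invariant_of_isRepresentation (hF : IsPerturbation n F) {θ : ℂ → ℂ} (hθ : IsInner θ)
    {p q : Fin n → ℂ[X]} {φ : Fin n → HardySpace}
    (h : IsRepresentation n (Mz + F) M θ p q φ) : ∀ f ∈ M, (Mz + F) f ∈ M := by
  suffices hle : M ≤ M.comap (Mz + F).toLinearMap from hle
  conv_lhs => rw [h.eq_sup]
  have hR : multRange n θ ≤ M := h.eq_sup ▸ le_sup_right
  refine sup_le (Submodule.span_le.mpr ?_) fun g hg => hR (hF.map_mem_multRange hθ hg)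
  rintro _ ⟨j, rfl⟩
  change (Mz + F) (φ j) ∈ M
  rcases (show (j : ℕ) + 1 ≤ n from j.2).lt_or_eq with hj | hj
  · have hle : Submodule.span ℂ (φ '' {i | j < i}) ⊔ multRange n θ ≤ M := by
      rw [h.eq_sup]
      exact sup_le_sup_right (Submodule.span_mono (Set.image_subset_range _ _)) _
    exact hle (h.map_mem j hj)
  · refine hR ⟨ofPoly (p j), fun z hz => ?_⟩
    rw [h.map_last j hj z hz, eval_ofPoly _ hz]
    ring

/-- A vector orthogonal to `zⁿ θ H²` that `(M_z + F)ⁿ⁻ⁱ` maps into `zⁿ θ H²` has the form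
`zⁱ p θ - q` with polynomials `p` and `q`: modulo a polynomial it equals `zⁱ θ h`, and orthogonality
forces the coefficients of `h` to vanish eventually. -/
theorem exists_polynomials (hF : IsPerturbation n F) {θ : HardySpace} (hθ : IsWandering θ)
    {i : ℕ} (hi : i ≤ n) {φ : HardySpace}
    (hφ : ((Mz + F) ^ (n - i)) φ ∈ multRange n (eval θ))
    (hperp : ∀ g ∈ multRange n (eval θ), inner ℂ φ g = 0) :
    ∃ p q : ℂ[X], ∀ z ∈ Metric.ball (0 : ℂ) 1,
      eval φ z = z ^ i * p.eval z * eval θ z - q.eval z ∧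
      eval (((Mz + F) ^ (n - i)) φ) z = z ^ n * p.eval z * eval θ z := by
  obtain ⟨h, hh⟩ := (hθ.mem_multRange_iff n _).mp hφ
  obtain ⟨q, hq⟩ := hF.exists_pow_apply_eq (n - i) φ
  have hsum : (Mz ^ i) (hθ.mulOp h) = φ + ofPoly q := by
    refine Mz_pow_injective (n - i) ?_
    rw [← hq, ← hh, ← mul_apply_eq_comp, ← pow_add, Nat.sub_add_cancel hi]
  have hcoeff : ∀ m, n + q.natDegree + 1 ≤ m → h m = 0 := by
    intro m hm
    have hθm : (Mz ^ i) (hθ.mulOp (monomial m)) = (Mz ^ (m + i)) θ := by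
      rw [hθ.mulOp_monomial, ← mul_apply_eq_comp, ← pow_add, add_comm]
    have h1 : inner ℂ ((Mz ^ (m + i)) θ) φ = 0 := by
      refine inner_eq_zero_symm.mp (hperp _ ((hθ.mem_multRange_iff n _).mpr
        ⟨monomial (m + i - n), ?_⟩))
      rw [hθ.mulOp_monomial, ← mul_apply_eq_comp, ← pow_add,
        show n + (m + i - n) = m + i by omega]
    have h2 : inner ℂ ((Mz ^ (m + i)) θ) (ofPoly q) = 0 := by
      refine (lp.hasSum_inner _ _).unique (hasSum_zero.congr_fun fun k => ?_)
      by_cases hk : k < m + i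
      · rw [Mz_pow_apply_of_lt _ _ hk, inner_zero_left]
      · rw [ofPoly_apply, Polynomial.coeff_eq_zero_of_natDegree_lt (by omega), inner_zero_right]
    rw [← inner_monomial_left, ← hθ.mulOp.inner_map_map, ← inner_Mz_pow_Mz_pow i, hθm, hsum,
      inner_add_right, h1, h2, add_zero]
  obtain ⟨p, rfl⟩ := exists_ofPoly_eq hcoeff
  refine ⟨p, q, fun z hz => ⟨?_, ?_⟩⟩
  · rw [eq_sub_of_add_eq hsum.symm, eval_sub _ _ hz, eval_Mz_pow _ _ hz, hθ.eval_mulOp _ hz,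
      eval_ofPoly _ hz, eval_ofPoly _ hz]
    ring
  · rw [← hh, eval_Mz_pow _ _ hz, hθ.eval_mulOp _ hz, eval_ofPoly _ hz]
    ring

/-- With `S = M_z + F`, the vectors `φᵢ` are chosen in the one-dimensional spaces
`Sⁱ M ⊖ Sⁱ⁺¹ M`, and `Sⁿ M = zⁿ θ H²`. -/
theorem exists_isRepresentation (hF : IsPerturbation n F)
    (hMc : IsClosed (M : Set HardySpace)) (hM : M ≠ ⊥) (hinv : ∀ f ∈ M, (Mz + F) f ∈ M) :
    ∃ (θ : ℂ → ℂ) (p q : Fin n → ℂ[X]) (φ : Fin n → HardySpace),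
      IsInner θ ∧ IsRepresentation n (Mz + F) M θ p q φ ∧ ∀ i, φ i ≠ 0 := by
  set S := Mz + F with hS
  -- `N i = Sⁱ M`
  let N (i : ℕ) : Submodule ℂ HardySpace := M.map (S ^ i).toLinearMap
  have hN0 : N 0 = M := by
    ext f
    exact ⟨fun ⟨g, hg, h⟩ => h ▸ hg, fun hf => ⟨f, hf, rfl⟩⟩
  have hNc : ∀ i, IsClosed (N i : Set HardySpace) := fun i =>
    (hF.isClosedEmbedding_pow i).isClosedMap _ hMc
  have hNsucc : ∀ i, ∀ f ∈ N i, S f ∈ N (i + 1) := by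
    rintro i _ ⟨g, hg, rfl⟩
    refine ⟨g, hg, ?_⟩
    change (S ^ (i + 1)) g = S ((S ^ i) g)
    rw [pow_succ', mul_apply_eq_comp]
  have hNsucc' : ∀ i, ∀ f ∈ N (i + 1), ∃ g ∈ N i, S g = f := by
    rintro i _ ⟨g, hg, rfl⟩
    refine ⟨(S ^ i) g, ⟨g, hg, rfl⟩, ?_⟩
    change S ((S ^ i) g) = (S ^ (i + 1)) g
    rw [pow_succ', mul_apply_eq_comp]
  have hNanti : Antitone N := by
    refine antitone_nat_of_succ_le fun i => ?_
    rintro _ ⟨g, hg, rfl⟩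
    refine ⟨S g, hinv g hg, ?_⟩
    change (S ^ i) (S g) = (S ^ (i + 1)) g
    rw [pow_succ, mul_apply_eq_comp]
  have hNinv : ∀ i, ∀ f ∈ N i, S f ∈ N i := fun i f hf => hNanti (Nat.le_succ i) (hNsucc i f hf)
  have hNpow : ∀ i k, ∀ f ∈ N i, (S ^ k) f ∈ N (k + i) := by
    rintro i k _ ⟨g, hg, rfl⟩
    refine ⟨g, hg, ?_⟩
    change (S ^ (k + i)) g = (S ^ k) ((S ^ i) g)
    rw [pow_add, mul_apply_eq_comp]
  have hNbot : ∀ i, N i ≠ ⊥ := by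
    intro i
    obtain ⟨f, hf, hf0⟩ := Submodule.exists_mem_ne_zero_of_ne_bot hM
    refine (Submodule.ne_bot_iff _).mpr ⟨(S ^ i) f, ⟨f, hf, rfl⟩, fun h => hf0 ?_⟩
    exact (hF.isClosedEmbedding_pow i).injective (h.trans (map_zero _).symm)
  obtain ⟨θ, hθ, hNn⟩ := hF.exists_eq_multRange (hNc n) (hNbot n) (hNinv n) (by
    rintro _ ⟨g, -, rfl⟩
    exact hF.raisesOrder.pow_apply n g)
  choose φ hφN hφ1 hφperp hφspan using fun i =>
    hF.exists_unit_generator (hNc i) (hNbot i) (hNinv i)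
  have hperp : ∀ i, ∀ g ∈ N (i + 1), inner ℂ (φ i) g = 0 := by
    intro i g hg
    obtain ⟨u, hu, rfl⟩ := hNsucc' i g hg
    exact hφperp i u hu
  have hspan : ∀ j ≤ n, N j ≤
      Submodule.span ℂ ((fun i : Fin n => φ i) '' {i | j ≤ (i : ℕ)}) ⊔ multRange n (eval θ) := by
    intro j hj
    induction hj using Nat.decreasingInduction with
    | self => rw [hNn]; exact le_sup_right
    | of_succ j hj ih =>
      intro f hf
      obtain ⟨c, h, hh, rfl⟩ := hφspan j f hf
      refine add_mem (Submodule.smul_mem _ _ (Submodule.mem_sup_left (Submodule.subset_span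
        ⟨⟨j, hj⟩, le_refl j, rfl⟩))) ?_
      refine (ih.trans (sup_le_sup_right (Submodule.span_mono (Set.image_mono fun i hi => ?_)) _))
        (hNsucc j h hh)
      exact (Nat.le_succ j).trans hi
  have hpoly : ∀ i : Fin n, ∃ p q : ℂ[X], ∀ z ∈ Metric.ball (0 : ℂ) 1,
      eval (φ i) z = z ^ (i : ℕ) * p.eval z * eval θ z - q.eval z ∧
      eval ((S ^ (n - i)) (φ i)) z = z ^ n * p.eval z * eval θ z := by
    intro i
    refine hF.exists_polynomials hθ i.2.le ?_ ?_
    · rw [← hNn]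
      have := hNpow i (n - i) (φ i) (hφN i)
      rwa [Nat.sub_add_cancel i.2.le] at this
    · rw [← hNn]
      exact fun g hg => hperp i g (hNanti i.2 hg)
  choose p q hpq using hpoly
  have horth : ∀ i j : ℕ, i < j → inner ℂ (φ i) (φ j) = 0 := fun i j hij =>
    hperp i _ (hNanti hij (hφN j))
  refine ⟨eval θ, p, q, fun i => φ i, hθ.isInner, ?_, fun i h => ?_⟩
  · refine ⟨fun i z hz => (hpq i z hz).1, fun i j hij => ?_, fun i g hg => ?_, ?_, fun j hj => ?_,
      fun j hj z hz => ?_⟩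
    · rcases (Fin.val_ne_of_ne hij).lt_or_gt with h | h
      · exact horth _ _ h
      · exact inner_eq_zero_symm.mp (horth _ _ h)
    · rw [← hNn] at hg
      exact hperp i g (hNanti i.2 hg)
    · refine le_antisymm ?_ (sup_le (Submodule.span_le.mpr ?_) ?_)
      · refine (hN0.ge.trans (hspan 0 (Nat.zero_le n))).trans ?_
        exact sup_le_sup_right (Submodule.span_mono (Set.image_subset_range _ _)) _
      · rintro _ ⟨i, rfl⟩
        exact hN0.le (hNanti (Nat.zero_le i) (hφN i))
      · rw [← hNn]
        exact (hNanti (Nat.zero_le n)).trans hN0.le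
    · exact hspan (j + 1) hj.le (hNsucc j _ (hφN j))
    · have := (hpq j z hz).2
      rwa [show n - (j : ℕ) = 1 by omega, pow_one] at this
  · have := hφ1 i
    simp only at h
    simp [h] at this

end IsPerturbation

end HardySpace

theorem mainTheorem2 (n : ℕ) (F : HardySpace →L[ℂ] HardySpace)
    (hF : HardySpace.IsPerturbation n F)
    (M : Submodule ℂ HardySpace) (hM_closed : IsClosed (M : Set HardySpace)) (hM : M ≠ ⊥) :
    ((∀ f ∈ M, (HardySpace.Mz + F) f ∈ M) ↔
      ∃ (θ : ℂ → ℂ) (p q : Fin n → ℂ[X]) (φ : Fin n → HardySpace),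
        HardySpace.IsInner θ ∧
        HardySpace.IsRepresentation n (HardySpace.Mz + F) M θ p q φ) ∧
    ((∀ f ∈ M, (HardySpace.Mz + F) f ∈ M) →
      ∃ (θ : ℂ → ℂ) (p q : Fin n → ℂ[X]) (φ : Fin n → HardySpace),
        HardySpace.IsInner θ ∧
        HardySpace.IsRepresentation n (HardySpace.Mz + F) M θ p q φ ∧
        ∀ i, φ i ≠ 0) := by
  refine ⟨⟨fun hinv => ?_, ?_⟩, fun hinv => hF.exists_isRepresentation hM_closed hM hinv⟩
  · obtain ⟨θ, p, q, φ, hθ, hrep, -⟩ := hF.exists_isRepresentation hM_closed hM hinv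
    exact ⟨θ, p, q, φ, hθ, hrep⟩
  · rintro ⟨θ, p, q, φ, hθ, hrep⟩
    exact hF.invariant_of_isRepresentation hθ hrep
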